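/- **Setting.** Let $K\ge 2$, let $(X,Y)$ be a random pair with law $\mathbb P$, where $X\in[0,1]^d$ and $Y\in\mathbb R^K$ is almost surely one of the $K$ standard basis vectors, and let $\mathbf p_0=(p^0_1,\dots,p^0_K)$, $p^0_k(\mathbf x)=\mathbb P(Y_k=1\mid X=\mathbf x)$, be the vector of true conditional class probabilities, with $\mathbf p_0(\mathbf x)$ a probability vector for every $\mathbf x\in[0,1]^d$. Let $\mathcal D_n=\{(X_i,Y_i)\}_{i=1}^n$ be i.i.d. copies of $(X,Y)$, independent of $X$. Let $\mathcal F$ be any class of conditional class probabilities, i.e. of measurable functions from $[0,1]^d$ to the probability simplex in $\mathbb R^K$, and let $\widehat{\mathbf p}$ be any estimator (a measurable function of $\mathcal D_n$ and $\mathbf x$) taking values in $\mathcal F$. Throughout $\log 0=-\infty$, $\log(a/0)=\infty$ for $a>0$, and products with a zero factor are $0$. Put $$R(\mathbf p_0,\mathbf p)=\mathbb E_{X}\big[\mathrm{KL}(\mathbf p_0(X),\mathbf p(X))\big]=\mathbb E_X\Big[\sum_{k=1}^K p^0_k(X)\log\frac{p^0_k(X)}{p_k(X)}\Big]\in[0,\infty],$$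 $$R_B(\mathbf p_0,\widehat{\mathbf p})=\mathbb E_{\mathcal D_n,X}\Big[\sum_{k=1}^K p^0_k(X)\Big(B\wedge\log\frac{p^0_k(X)}{\widehat p_k(X)}\Big)\Big],$$ $$\Delta_n(\mathbf p_0,\widehat{\mathbf p})=\mathbb E_{\mathcal D_n}\Big[-\frac1n\sum_{i=1}^n Y_i^\top\log\widehat{\mathbf p}(X_i)-\inf_{\mathbf p\in\mathcal F}\Big(-\frac1n\sum_{i=1}^n Y_i^\top\log\mathbf p(X_i)\Big)\Big]\in[0,\infty],$$ where logarithms of vectors are taken coordinatewise and the difference inside the last expectation is read as $0$ when both terms are $+\infty$. For $\tau\in\mathbb R$ let $$d_\tau(\mathbf f,\mathbf g)=\sup_{\mathbf x\in[0,1]^d}\max_{1\le k\le K}\big|(\tau\vee f_k(\mathbf x))-(\tau\vee g_k(\mathbf x))\big|,$$ let $\log(\mathcal F)=\{\log\mathbf f:\mathbf f\in\mathcal F\}$, and let $\mathcal N(\delta,\log(\mathcal F),d_\tau)\in\mathbb N\cup\{\infty\}$ be the interior covering number: the minimal number of closed $d_\tau$-balls of radius $\delta$ with centers in $\log(\mathcal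 F)$ needed to cover $\log(\mathcal F)$. **Theorem (Oracle Inequality).** Let $B\ge 2$, $\delta,\epsilon\in(0,1]$ and $0<C_n\le n/e$. If $\mathcal N_n:=\mathcal N(\delta,\log(\mathcal F),d_\tau)\ge 3$ for $\tau=\log(C_ne^{-B}/n)$, then $$R_B(\mathbf p_0,\widehat{\mathbf p})\le(1+\epsilon)\Big(\inf_{\mathbf p\in\mathcal F}R(\mathbf p_0,\mathbf p)+\Delta_n(\mathbf p_0,\widehat{\mathbf p})+3\delta\Big)+\frac{(1+\epsilon)^2}{\epsilon}\cdot\frac{68B\log(\mathcal N_n)+272B+\tfrac32C_nK\big(\log(\tfrac n{C_n})+B\big)}{n}.$$ -/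

import Mathlib

open MeasureTheory
open scoped ENNReal NNReal

noncomputable section

/-- The design space `[0,1]^d`. -/
abbrev Cube (d : ℕ) : Type := Fin d → unitInterval

/-- One observation `(x, y)`: a design vector in `[0,1]^d` and a response vector in `ℝ^K`. -/
abbrev Obs (d K : ℕ) : Type := Cube d × (Fin K → ℝ)

/-- Conditional class probabilities: measurable maps from `[0,1]^d` to the probability simplex. -/
def IsClassProb {d K : ℕ} (p : Cube d → Fin K → ℝ) : Prop :=
  Measurable p ∧ ∀ x, p x ∈ stdSimplex ℝ (Fin K)

/-- The response vector is almost surely one of the `K` standard basis vectors. -/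
def HasBasisResponse {d K : ℕ} (P : Measure (Obs d K)) : Prop :=
  ∀ᵐ z ∂P, ∃ k : Fin K, z.2 = Pi.single k 1

/-- `p₀` is (a version of) the vector of true conditional class probabilities
`p₀ x k = P(Y_k = 1 | X = x)` under the joint law `P` of `(X, Y)`; `P.fst` is the law of `X`. -/
def IsTrueClassProb {d K : ℕ} (P : Measure (Obs d K)) (p₀ : Cube d → Fin K → ℝ) : Prop :=
  IsClassProb p₀ ∧
    ∀ (k : Fin K) (A : Set (Cube d)), MeasurableSet A →
      P {z | z.1 ∈ A ∧ z.2 k = 1} = ∫⁻ x in A, ENNReal.ofReal (p₀ x k) ∂P.fst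

/-- The law of the dataset of `n` i.i.d. observations with law `P`. -/
def dataLaw {d K : ℕ} (n : ℕ) (P : Measure (Obs d K)) : Measure (Fin n → Obs d K) :=
  Measure.pi fun _ => P

/-- The Kullback-Leibler divergence `∑ k, p_k log (p_k / q_k)` of two probability vectors;
it is infinite if `p` is not dominated by `q`, and `0 log 0 = 0`. -/
def klVec {K : ℕ} (p q : Fin K → ℝ) : ℝ≥0∞ :=
  open Classical in
  if ∀ k, q k = 0 → p k = 0 then ENNReal.ofReal (∑ k, p k * Real.log (p k / q k)) else ∞

/-- The `B`-truncated Kullback-Leibler divergence `∑ k, p_k (B ∧ log (p_k / q_k))`, where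
`log (p_k / 0) = ∞` for `p_k > 0`, so that the truncated logarithm is `B` there; the terms with
`p_k = 0` are zero. -/
def klTrunc {K : ℕ} (B : ℝ) (p q : Fin K → ℝ) : ℝ :=
  ∑ k, p k * (if q k = 0 then B else min B (Real.log (p k / q k)))

/-- The risk `R(p₀, p) = E_X [KL(p₀(X), p(X))]` of a nonrandom `p`. -/
def risk {d K : ℕ} (P : Measure (Obs d K)) (p₀ p : Cube d → Fin K → ℝ) : ℝ≥0∞ :=
  ∫⁻ x, klVec (p₀ x) (p x) ∂P.fst

/-- The truncated risk `R_B(p₀, p̂) = E_{D,X} [KL_B(p₀(X), p̂(X))]` of an estimator, the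
expectation being over the dataset `D` and an independent design vector `X`. -/
def truncRisk {d K n : ℕ} (P : Measure (Obs d K)) (B : ℝ) (p₀ : Cube d → Fin K → ℝ)
    (phat : (Fin n → Obs d K) → Cube d → Fin K → ℝ) : ℝ :=
  ∫ z, klTrunc B (p₀ z.2) (phat z.1 z.2) ∂((dataLaw n P).prod P.fst)

/-- The extended logarithm of a nonnegative real, with `log 0 = -∞`. -/
def elog (u : ℝ) : EReal := ENNReal.log (ENNReal.ofReal u)

/-- The cross-entropy loss `-(1/n) ∑ i, ∑ k, Y_{ik} log (p_k(X_i))` of `p` on a dataset, in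
`[0, ∞]` for probability-vector-valued `p`, with `0 · log 0 = 0`. -/
def ceLoss {d K n : ℕ} (p : Cube d → Fin K → ℝ) (D : Fin n → Obs d K) : ℝ≥0∞ :=
  (∑ i, ∑ k, ENNReal.ofReal ((D i).2 k) * (-elog (p (D i).1 k)).toENNReal) / n

/-- `Δ_n`: the expected difference of the empirical risk of the estimator and the infimum of the
empirical risk over the class `F`. -/
def deltaN {d K n : ℕ} (P : Measure (Obs d K)) (F : Set (Cube d → Fin K → ℝ))
    (phat : (Fin n → Obs d K) → Cube d → Fin K → ℝ) : ℝ≥0∞ :=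
  ∫⁻ D, (ceLoss (phat D) D - ⨅ p ∈ F, ceLoss p D) ∂(dataLaw n P)

/-- The class `log(F)`, the logarithm being taken coordinatewise. -/
def logClass {d K : ℕ} (F : Set (Cube d → Fin K → ℝ)) : Set (Cube d → Fin K → EReal) :=
  (fun p x k => elog (p x k)) '' F

/-- `d_τ(f, g) = sup_x max_k |(τ ∨ f_k(x)) - (τ ∨ g_k(x))|`, for functions with values in
`[-∞, ∞)`, for which `τ ∨ f_k(x)` is a real number. -/
def dTrunc {d K : ℕ} (τ : ℝ) (f g : Cube d → Fin K → EReal) : ℝ≥0∞ :=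
  ⨆ x, ⨆ k, ENNReal.ofReal |(max (τ : EReal) (f x k)).toReal - (max (τ : EReal) (g x k)).toReal|

/-- `d_τ` as a (possibly infinite) pseudometric on functions. -/
@[reducible] def dTruncSpace {d K : ℕ} (τ : ℝ) : PseudoEMetricSpace (Cube d → Fin K → EReal) where
  edist := dTrunc τ
  edist_self f := by simp [dTrunc]
  edist_comm f g := by simp only [dTrunc, abs_sub_comm]
  edist_triangle f g h := by
    refine iSup_le fun x => iSup_le fun k => ?_
    refine le_trans (ENNReal.ofReal_le_ofReal (abs_sub_le _
      ((max (τ : EReal) (g x k)).toReal) _)) ?_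
    rw [ENNReal.ofReal_add (abs_nonneg _) (abs_nonneg _)]
    exact add_le_add
      (le_iSup_of_le x (le_iSup_of_le k le_rfl)) (le_iSup_of_le x (le_iSup_of_le k le_rfl))

/-- The interior `δ`-covering number of `G` with respect to `d_τ`. -/
def coverNum {d K : ℕ} (τ δ : ℝ) (G : Set (Cube d → Fin K → EReal)) : ℕ∞ :=
  @Metric.coveringNumber _ (dTruncSpace τ) δ.toNNReal G

end

/-!
The proof compares the truncated log-ratio `g_p = B ∧ log (p₀ / p)`, evaluated at the observed class,
in expectation and in empirical mean.

*One function.* If `r = p / p₀`, then `exp (-s g_p)` is `max (r, exp (-B)) ^ s`. For `s = κ / (2B)`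
and `B ≥ 2` this power lies below `1 - (1 - κ) s g_p + s κ (r - 1)` (`mul_exp_neg_truncLog_le`).
Weighting by `p₀` and summing over the classes removes the last term, since both `p₀` and `p` sum
to one, so that `E exp (-s g_p) ≤ 1 - (1 - κ) s E g_p ≤ exp (-(1 - κ) s E g_p)`. By independence,
`exp (n s ((1 - κ) E g_p - P_n g_p))` has expectation at most one
(`integral_exp_deviation_le_one`). This is a one-sided multiplicative deviation bound without
residual variance term, and it needs no lower bound on `g_p`.

*Finitely many functions.* The maximum of `(1 - κ) E g_p - P_n g_p` over `N` centers therefore has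
expectation at most `log N / (n s)` (`le_log_card_add_sum_exp`).

*From the estimator to a center.* Where `p₀ ≥ C / n`, the truncation at `B` makes `g_p` insensitive to
values of `log p` below `τ`, so that functions at `d_τ`-distance `δ` have values of `g` at distance
`δ`. On the remaining coordinates `|g_p - g_q| ≤ B - log p₀`, and the expectation of that bound is
at most `K (C / n) (B + log (n / C))`, because `a (B - log a)` increases on `[0, 1/e]`
(`abs_truncLog_sub_le`, `mul_sub_log_le`). Together this gives `truncRisk_le_of_cover`.

*The empirical mean at the estimator.* Since `g_p + log (1 / p₀)` is at most the negative
log-likelihood, adding the (finite) entropy of `p₀` shows that the expectation of `P_n g` at the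
estimator is at most `R(p₀, p) + Δ_n` for every `p` in the class
(`ofReal_integral_sampleMean_estimator_le`). The infimum inside `Δ_n` is only ever compared with
the loss of a single `p`, so its measurability plays no role.

The theorem is the case `κ = ε / (1 + ε)`, in which `1 - κ = 1 / (1 + ε)`.
-/

/-! ### The truncated logarithm -/

/-- The truncated logarithmic ratio `B ∧ log (a / b)`, with value `B` for `b = 0`. -/
noncomputable def truncLog (B a b : ℝ) : ℝ := if b = 0 then B else min B (Real.log (a / b))

lemma klTrunc_eq_sum_truncLog {K : ℕ} (B : ℝ) (p q : Fin K → ℝ) :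
    klTrunc B p q = ∑ k, p k * truncLog B (p k) (q k) := rfl

lemma measurable_truncLog (B : ℝ) : Measurable fun z : ℝ × ℝ => truncLog B z.1 z.2 := by
  unfold truncLog
  refine Measurable.ite (measurable_snd (measurableSet_singleton 0)) measurable_const ?_
  fun_prop

lemma truncLog_le (B a b : ℝ) : truncLog B a b ≤ B := by
  unfold truncLog
  split_ifs <;> simp

/-- For `a = 0` this holds because `Real.log 0 = 0`. -/
lemma log_le_truncLog {B a b : ℝ} (hB : 0 ≤ B) (ha : 0 ≤ a) (ha1 : a ≤ 1) (hb : 0 ≤ b)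
    (hb1 : b ≤ 1) : Real.log a ≤ truncLog B a b := by
  have h0 : Real.log a ≤ 0 := Real.log_nonpos ha ha1
  unfold truncLog
  split_ifs with h
  · linarith
  · refine le_min (by linarith) ?_
    rcases ha.eq_or_lt with rfl | ha'
    · simp
    · rw [Real.log_div ha'.ne' h]
      linarith [Real.log_nonpos hb hb1]

lemma abs_truncLog_le {B a b : ℝ} (hB : 0 ≤ B) (ha : 0 ≤ a) (ha1 : a ≤ 1) (hb : 0 ≤ b)
    (hb1 : b ≤ 1) : |truncLog B a b| ≤ B - Real.log a := by
  have h0 : Real.log a ≤ 0 := Real.log_nonpos ha ha1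
  have h1 := log_le_truncLog hB ha ha1 hb hb1
  have h2 := truncLog_le B a b
  rw [abs_le]
  constructor <;> linarith

lemma sub_le_mul_truncLog {B a b : ℝ} (hB : 1 ≤ B) (ha : 0 ≤ a) (hb : 0 ≤ b) :
    a - b ≤ a * truncLog B a b := by
  rcases ha.eq_or_lt with rfl | ha'
  · simpa using hb
  have h1 : 1 - b / a ≤ truncLog B a b := by
    have hba : 0 ≤ b / a := by positivity
    unfold truncLog
    split_ifs with h
    · linarith
    · refine le_min (by linarith) ?_
      have hb' : 0 < b := lt_of_le_of_ne hb (Ne.symm h)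
      have := Real.log_le_sub_one_of_pos (div_pos hb' ha')
      rw [← inv_div, Real.log_inv, inv_div] at this
      linarith
  calc a - b = a * (1 - b / a) := by field_simp
    _ ≤ _ := by gcongr

lemma mul_neg_log_le_one {a : ℝ} (ha : 0 ≤ a) : a * -Real.log a ≤ 1 := by
  rcases ha.eq_or_lt with rfl | ha'
  · simp
  have := Real.log_le_sub_one_of_pos (inv_pos.2 ha')
  rw [Real.log_inv] at this
  calc a * -Real.log a ≤ a * (a⁻¹ - 1) := by gcongr
    _ = 1 - a := by field_simp
    _ ≤ 1 := by linarith

/-- The function `a ↦ -a log a` is increasing on `[0, 1/e]`. -/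
lemma mul_sub_log_le {B a m : ℝ} (hB : 0 ≤ B) (ha : 0 ≤ a) (ham : a ≤ m) (hm : 0 < m)
    (hme : Real.log m ≤ -1) : a * (B - Real.log a) ≤ m * (B - Real.log m) := by
  rcases ha.eq_or_lt with rfl | ha'
  · simp only [zero_mul]
    exact mul_nonneg hm.le (by linarith)
  have h1 := Real.log_le_sub_one_of_pos (div_pos hm ha')
  rw [Real.log_div hm.ne' ha'.ne'] at h1
  have h2 : a * (Real.log m - Real.log a) ≤ m - a :=
    calc a * (Real.log m - Real.log a) ≤ a * (m / a - 1) := by gcongr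
      _ = m - a := by field_simp
  nlinarith

lemma exp_mul_sub_le {s u : ℝ} (hs : 0 ≤ s) (hs1 : s ≤ 1) (hu : 0 ≤ u) :
    Real.exp (s * u) - 1 - s * u ≤ s ^ 2 * (Real.exp u - 1 - u) := by
  have hmono : Monotone fun u : ℝ =>
      s ^ 2 * (Real.exp u - 1 - u) - (Real.exp (s * u) - 1 - s * u) := by
    refine monotone_of_hasDerivAt_nonneg
      (f' := fun u => s ^ 2 * (Real.exp u - 1) - (Real.exp (s * u) * s - s)) ?_ ?_
    · intro u
      have h1 : HasDerivAt (fun u : ℝ => s * u) s u := by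
        simpa using (hasDerivAt_id u).const_mul s
      exact ((((Real.hasDerivAt_exp u).sub_const 1).sub (hasDerivAt_id u)).const_mul _).sub
        ((h1.exp.sub_const 1).sub h1)
    · intro u
      -- Convexity of the exponential between `0` and `u`.
      have hc := convexOn_exp.2 (Set.mem_univ 0) (Set.mem_univ u) (sub_nonneg.2 hs1) hs
        (by ring)
      simp only [smul_eq_mul, mul_zero, zero_add, Real.exp_zero, mul_one] at hc
      change 0 ≤ s ^ 2 * (Real.exp u - 1) - (Real.exp (s * u) * s - s)
      nlinarith
  have := hmono hu
  simp only [mul_zero, Real.exp_zero] at this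
  linarith

/-- With `s = κ / (2B)`, the left side is of order `s² u² / 2`. For negative `u` the function
`exp u - 1 - u` on the right grows only linearly, but `u² ≤ 2B (exp u - 1 - u)` on `[-B, 0]`; this
loss of a factor `2B` determines the choice of `s`. -/
lemma exp_mul_sub_le_of_neg_le {B κ u : ℝ} (hB : 2 ≤ B) (hκ : 0 ≤ κ) (hκ1 : κ ≤ 1)
    (hu : -B ≤ u) :
    Real.exp (κ / (2 * B) * u) - 1 - κ / (2 * B) * u ≤
      κ / (2 * B) * (κ * (Real.exp u - 1 - u)) := by
  have hs : 0 ≤ κ / (2 * B) := by positivity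
  have hsκ : κ / (2 * B) ≤ κ := div_le_self hκ (by linarith)
  have hsB : κ / (2 * B) * (2 * B) = κ := by field_simp
  set s := κ / (2 * B)
  have hexp := Real.add_one_le_exp u
  rcases le_total 0 u with h | h
  · refine (exp_mul_sub_le hs (hsκ.trans hκ1) h).trans ?_
    rw [sq, mul_assoc]
    gcongr
    linarith
  · have h1 : |s * u| ≤ 1 := by
      rw [abs_mul, abs_of_nonneg hs, abs_of_nonpos h]
      nlinarith
    have h2 := (abs_le.1 (Real.abs_exp_sub_one_sub_id_le h1)).2
    have h3 : u ^ 2 ≤ 2 * B * (Real.exp u - 1 - u) := by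
      rcases le_total (-2) u with h' | h'
      · have h4 : (1 + u / 2) ^ 2 ≤ Real.exp u := by
          have : Real.exp u = Real.exp (u / 2) ^ 2 := by
            rw [sq, ← Real.exp_add]; ring_nf
          rw [this]
          have := Real.add_one_le_exp (u / 2)
          gcongr
          · linarith
          · linarith
        nlinarith
      · have := Real.exp_pos u
        nlinarith
    calc _ ≤ (s * u) ^ 2 := h2
      _ = s * (s * u ^ 2) := by ring
      _ ≤ s * (s * (2 * B * (Real.exp u - 1 - u))) := by gcongr
      _ = s * (s * (2 * B) * (Real.exp u - 1 - u)) := by ring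
      _ = _ := by rw [hsB]

/-- The tangent-line bound behind the exponential moment: after summation over the coordinates of
two probability vectors, the last term drops out. -/
lemma mul_exp_neg_truncLog_le {B κ a b : ℝ} (hB : 2 ≤ B) (hκ : 0 ≤ κ) (hκ1 : κ ≤ 1)
    (ha : 0 ≤ a) (hb : 0 ≤ b) :
    a * Real.exp (-(κ / (2 * B) * truncLog B a b)) ≤
      a - (1 - κ) * (κ / (2 * B)) * (a * truncLog B a b) + κ / (2 * B) * κ * (b - a) := by
  have hs : 0 ≤ κ / (2 * B) := by positivity
  rcases ha.eq_or_lt with rfl | ha'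
  · simp only [zero_mul, mul_zero, sub_zero, zero_add]
    positivity
  set t := truncLog B a b with ht
  have htB : t ≤ B := truncLog_le B a b
  have key := exp_mul_sub_le_of_neg_le hB hκ hκ1 (neg_le_neg htB)
  have hr : t ≠ B → Real.exp (-t) = b / a := by
    intro h
    have hb0 : b ≠ 0 := fun h0 => h (by simp [ht, truncLog, h0])
    have : t = Real.log (a / b) := by
      rw [ht, truncLog, if_neg hb0] at h ⊢
      exact (min_choice B (Real.log (a / b))).resolve_left h
    rw [this, ← Real.log_inv, inv_div,
      Real.exp_log (div_pos (lt_of_le_of_ne hb (Ne.symm hb0)) ha')]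
  have main : Real.exp (-(κ / (2 * B) * t)) ≤
      1 - (1 - κ) * (κ / (2 * B)) * t + κ / (2 * B) * κ * (b / a - 1) := by
    by_cases h : t = B
    -- Where the truncation is active, `b / a` may be anything in `[0, exp (-B)]`.
    · have hsB : κ / (2 * B) * (2 * B) = κ := by field_simp
      set s := κ / (2 * B)
      have h1 : |-(s * t)| ≤ 1 := by
        rw [abs_neg, h, abs_of_nonneg (by positivity)]
        nlinarith
      have h2 := (abs_le.1 (Real.abs_exp_sub_one_sub_id_le h1)).2
      have hba : 0 ≤ b / a := by positivity
      have h3 : (-(s * t)) ^ 2 ≤ s * κ * (t - 1) := by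
        rw [h]
        have : (-(s * B)) ^ 2 = s * κ * (B / 2) := by rw [← hsB]; ring
        rw [this]
        gcongr
        linarith
      have h4 : 0 ≤ s * κ * (b / a) := by positivity
      nlinarith
    · rw [hr h, mul_neg] at key
      linarith
  calc a * Real.exp (-(κ / (2 * B) * t))
      ≤ a * (1 - (1 - κ) * (κ / (2 * B)) * t + κ / (2 * B) * κ * (b / a - 1)) := by gcongr
    _ = _ := by field_simp

lemma sum_mul_exp_neg_truncLog_le {K : ℕ} {B κ : ℝ} (hB : 2 ≤ B) (hκ : 0 ≤ κ) (hκ1 : κ ≤ 1)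
    {p q : Fin K → ℝ} (hp : p ∈ stdSimplex ℝ (Fin K)) (hq : q ∈ stdSimplex ℝ (Fin K)) :
    ∑ k, p k * Real.exp (-(κ / (2 * B) * truncLog B (p k) (q k))) ≤
      1 - (1 - κ) * (κ / (2 * B)) * klTrunc B p q := by
  refine (Finset.sum_le_sum fun k _ =>
    mul_exp_neg_truncLog_le hB hκ hκ1 (hp.1 k) (hq.1 k)).trans_eq ?_
  rw [Finset.sum_add_distrib, Finset.sum_sub_distrib, ← Finset.mul_sum, ← Finset.mul_sum,
    Finset.sum_sub_distrib, hp.2, hq.2, klTrunc_eq_sum_truncLog]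
  ring

lemma klTrunc_nonneg {K : ℕ} {B : ℝ} (hB : 1 ≤ B) {p q : Fin K → ℝ}
    (hp : p ∈ stdSimplex ℝ (Fin K)) (hq : q ∈ stdSimplex ℝ (Fin K)) : 0 ≤ klTrunc B p q := by
  rw [klTrunc_eq_sum_truncLog]
  calc 0 = ∑ k, (p k - q k) := by rw [Finset.sum_sub_distrib, hp.2, hq.2, sub_self]
    _ ≤ _ := Finset.sum_le_sum fun k _ => sub_le_mul_truncLog hB (hp.1 k) (hq.1 k)

lemma klTrunc_le {K : ℕ} {B : ℝ} {p : Fin K → ℝ} (hp : p ∈ stdSimplex ℝ (Fin K))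
    (q : Fin K → ℝ) : klTrunc B p q ≤ B := by
  rw [klTrunc_eq_sum_truncLog]
  calc _ ≤ ∑ k, p k * B := Finset.sum_le_sum fun k _ =>
        mul_le_mul_of_nonneg_left (truncLog_le _ _ _) (hp.1 k)
    _ = B := by rw [← Finset.sum_mul, hp.2, one_mul]

/-! ### Truncation and the distance `d_τ` -/

lemma elog_of_pos {u : ℝ} (hu : 0 < u) : elog u = (Real.log u : EReal) := by
  rw [elog, ENNReal.log_ofReal_of_pos hu]

lemma elog_zero : elog 0 = ⊥ := by simp [elog]

/-- For `a ≥ m`, a logarithm `log b` below `log m - B` is invisible after truncation. -/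
lemma truncLog_eq_min_sub_toReal {B a b m : ℝ} (hm : 0 < m) (ha : m ≤ a) (hb : 0 ≤ b) :
    truncLog B a b =
      min B (Real.log a - (max ((Real.log m - B : ℝ) : EReal) (elog b)).toReal) := by
  have hlog := Real.log_le_log hm ha
  rcases hb.eq_or_lt with rfl | hb'
  · rw [elog_zero, max_eq_left bot_le, EReal.toReal_coe, truncLog, if_pos rfl, min_eq_left]
    linarith
  · rw [elog_of_pos hb', ← EReal.coe_strictMono.monotone.map_max, EReal.toReal_coe, truncLog, if_neg hb'.ne',
      Real.log_div (hm.trans_le ha).ne' hb'.ne']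
    rcases le_total (Real.log m - B) (Real.log b) with h | h
    · rw [max_eq_right h]
    · rw [max_eq_left h, min_eq_left (by linarith), min_eq_left (by linarith)]

lemma abs_truncLog_sub_le {B a b b' m δ : ℝ} (hB : 0 ≤ B) (hm : 0 < m) (hδ : 0 ≤ δ)
    (ha : 0 ≤ a) (ha1 : a ≤ 1) (hb : 0 ≤ b) (hb1 : b ≤ 1) (hb' : 0 ≤ b') (hb1' : b' ≤ 1)
    (h : |(max ((Real.log m - B : ℝ) : EReal) (elog b)).toReal -
      (max ((Real.log m - B : ℝ) : EReal) (elog b')).toReal| ≤ δ) :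
    |truncLog B a b - truncLog B a b'| ≤ δ + if a < m then B - Real.log a else 0 := by
  split_ifs with ham
  · have h1 := log_le_truncLog hB ha ha1 hb hb1
    have h2 := log_le_truncLog hB ha ha1 hb' hb1'
    have h3 := truncLog_le B a b
    have h4 := truncLog_le B a b'
    rw [abs_le]
    constructor <;> linarith
  · push Not at ham
    rw [truncLog_eq_min_sub_toReal hm ham hb, truncLog_eq_min_sub_toReal hm ham hb', add_zero]
    refine (abs_min_sub_min_le_max _ _ _ _).trans (max_le (by simpa using hδ) ?_)
    rw [abs_sub_comm] at h
    rwa [sub_sub_sub_cancel_left]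

/-! ### Evaluation at the observed class -/

/-- The value of `φ x k` at an observation `(x, y)` of class `k`, extended linearly to all
responses `y`. -/
def obsEval {d K : ℕ} (φ : Cube d → Fin K → ℝ) (z : Obs d K) : ℝ := ∑ k, z.2 k * φ z.1 k

/-- The empirical mean of `obsEval φ` over a dataset. -/
noncomputable def sampleMean {d K n : ℕ} (φ : Cube d → Fin K → ℝ) (D : Fin n → Obs d K) : ℝ :=
  (∑ i, obsEval φ (D i)) / n

/-- The truncated logarithmic ratio `B ∧ log (p₀ / p)`, coordinatewise. -/
noncomputable def truncLogRatio {d K : ℕ} (B : ℝ) (p₀ p : Cube d → Fin K → ℝ) :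
    Cube d → Fin K → ℝ := fun x k => truncLog B (p₀ x k) (p x k)

lemma obsEval_of_eq_single {d K : ℕ} (φ : Cube d → Fin K → ℝ) {z : Obs d K} {k : Fin K}
    (hz : z.2 = Pi.single k 1) : obsEval φ z = φ z.1 k := by
  simp [obsEval, hz, Pi.single_apply]

lemma measurable_obsEval {d K : ℕ} {φ : Cube d → Fin K → ℝ} (hφ : Measurable φ) :
    Measurable (obsEval φ) := by
  unfold obsEval
  fun_prop

lemma measurable_truncLogRatio {d K : ℕ} (B : ℝ) {p₀ p : Cube d → Fin K → ℝ}
    (hp₀ : Measurable p₀) (hp : Measurable p) : Measurable (truncLogRatio B p₀ p) := by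
  refine measurable_pi_lambda _ fun k => ?_
  exact (measurable_truncLog B).comp (f := fun x => (p₀ x k, p x k)) (by fun_prop)

lemma coord_mem_Icc {K : ℕ} {p : Fin K → ℝ} (hp : p ∈ stdSimplex ℝ (Fin K)) (k : Fin K) :
    0 ≤ p k ∧ p k ≤ 1 := mem_Icc_of_mem_stdSimplex hp k

section Transfer

variable {d K : ℕ} {P : Measure (Obs d K)} {p₀ : Cube d → Fin K → ℝ}

/-- Weighting the observations by `Y_k` and projecting to the design space gives the law of `X`
weighted by the conditional probability of class `k`. -/
lemma map_fst_withDensity_response [IsProbabilityMeasure P] (hP : HasBasisResponse P)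
    (hp₀ : IsTrueClassProb P p₀) (k : Fin K) :
    (P.withDensity fun z => ENNReal.ofReal (z.2 k)).map Prod.fst =
      P.fst.withDensity fun x => ENNReal.ofReal (p₀ x k) := by
  ext A hA
  have hone : MeasurableSet {z : Obs d K | z.2 k = 1} :=
    (measurable_pi_apply k |>.comp measurable_snd) (measurableSet_singleton 1)
  rw [Measure.map_apply measurable_fst hA, withDensity_apply _ hA, ← hp₀.2 k A hA,
    withDensity_apply _ (measurable_fst hA)]
  have hae : ∀ᵐ z ∂P.restrict (Prod.fst ⁻¹' A),
      ENNReal.ofReal (z.2 k) = {z : Obs d K | z.2 k = 1}.indicator 1 z := by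
    refine ae_restrict_of_ae ?_
    filter_upwards [hP] with z ⟨j, hj⟩
    by_cases h : k = j
    · subst h
      simp [hj]
    · simp [hj, h]
  rw [lintegral_congr_ae hae, lintegral_indicator_one hone, Measure.restrict_apply hone]
  congr 1
  ext z
  simp [and_comm]

lemma lintegral_response_mul [IsProbabilityMeasure P] (hP : HasBasisResponse P)
    (hp₀ : IsTrueClassProb P p₀) (k : Fin K) {ψ : Cube d → ℝ≥0∞} (hψ : Measurable ψ) :
    ∫⁻ z, ENNReal.ofReal (z.2 k) * ψ z.1 ∂P =
      ∫⁻ x, ENNReal.ofReal (p₀ x k) * ψ x ∂P.fst := by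
  have hm : Measurable fun z : Obs d K => ENNReal.ofReal (z.2 k) := by fun_prop
  have hm0 : Measurable fun x => ENNReal.ofReal (p₀ x k) := by
    have := hp₀.1.1
    fun_prop
  have h := lintegral_map (μ := P.withDensity fun z => ENNReal.ofReal (z.2 k)) hψ measurable_fst
  rw [map_fst_withDensity_response hP hp₀ k,
    lintegral_withDensity_eq_lintegral_mul _ hm0 hψ] at h
  exact ((lintegral_withDensity_eq_lintegral_mul P hm (hψ.comp measurable_fst)).symm.trans
    h.symm)

lemma response_nonneg_ae (hP : HasBasisResponse P) (k : Fin K) : ∀ᵐ z ∂P, 0 ≤ z.2 k := by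
  filter_upwards [hP] with z ⟨j, hj⟩
  rw [hj, Pi.single_apply]
  split_ifs <;> norm_num

lemma integrable_and_integral_response_mul [IsProbabilityMeasure P] (hP : HasBasisResponse P)
    (hp₀ : IsTrueClassProb P p₀) (k : Fin K) {f : Cube d → ℝ} (hf : Measurable f)
    (hint : Integrable (fun x => p₀ x k * f x) P.fst) :
    Integrable (fun z : Obs d K => z.2 k * f z.1) P ∧
      ∫ z, z.2 k * f z.1 ∂P = ∫ x, p₀ x k * f x ∂P.fst := by
  have hm : Measurable fun z : Obs d K => ENNReal.ofReal (z.2 k) := by fun_prop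
  have hm0 : Measurable fun x => ENNReal.ofReal (p₀ x k) := by
    have := hp₀.1.1
    fun_prop
  have hae : (fun z : Obs d K => (ENNReal.ofReal (z.2 k)).toReal • f z.1) =ᵐ[P]
      fun z => z.2 k * f z.1 := by
    filter_upwards [response_nonneg_ae hP k] with z hz
    rw [ENNReal.toReal_ofReal hz, smul_eq_mul]
  have heq : (fun x => (ENNReal.ofReal (p₀ x k)).toReal • f x) = fun x => p₀ x k * f x := by
    ext x
    rw [ENNReal.toReal_ofReal ((hp₀.1.2 x).1 k), smul_eq_mul]
  constructor
  · rw [← integrable_congr hae]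
    refine (integrable_withDensity_iff_integrable_smul' hm (by simp)).1 ?_
    change Integrable (f ∘ Prod.fst) _
    rw [← integrable_map_measure hf.aestronglyMeasurable measurable_fst.aemeasurable,
      map_fst_withDensity_response hP hp₀ k,
      integrable_withDensity_iff_integrable_smul' hm0 (by simp), heq]
    exact hint
  · rw [← integral_congr_ae hae,
      ← integral_withDensity_eq_integral_toReal_smul hm (by simp) (fun z => f z.1),
      ← integral_map measurable_fst.aemeasurable hf.aestronglyMeasurable,
      map_fst_withDensity_response hP hp₀ k,
      integral_withDensity_eq_integral_toReal_smul hm0 (by simp), heq]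

variable [IsProbabilityMeasure P] {φ : Cube d → Fin K → ℝ}

lemma integrable_obsEval (hP : HasBasisResponse P) (hp₀ : IsTrueClassProb P p₀)
    (hφ : Measurable φ) (hint : ∀ k, Integrable (fun x => p₀ x k * φ x k) P.fst) :
    Integrable (obsEval φ) P :=
  integrable_finsetSum _ fun k _ =>
    (integrable_and_integral_response_mul hP hp₀ k (by fun_prop) (hint k)).1

lemma integral_obsEval (hP : HasBasisResponse P) (hp₀ : IsTrueClassProb P p₀)
    (hφ : Measurable φ) (hint : ∀ k, Integrable (fun x => p₀ x k * φ x k) P.fst) :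
    ∫ z, obsEval φ z ∂P = ∫ x, ∑ k, p₀ x k * φ x k ∂P.fst := by
  have h k := integrable_and_integral_response_mul hP hp₀ k (f := fun x => φ x k)
    (by fun_prop) (hint k)
  simp only [obsEval]
  rw [integral_finsetSum _ fun k _ => (h k).1, integral_finsetSum _ fun k _ => hint k]
  exact Finset.sum_congr rfl fun k _ => (h k).2

variable {n : ℕ}

instance isProbabilityMeasure_dataLaw : IsProbabilityMeasure (dataLaw n P) := by
  unfold dataLaw
  infer_instance

lemma measurePreserving_eval_dataLaw (i : Fin n) :
    MeasurePreserving (fun D : Fin n → Obs d K => D i) (dataLaw n P) P :=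
  measurePreserving_eval (fun _ : Fin n => P) i

lemma basisResponse_dataLaw (hP : HasBasisResponse P) :
    ∀ᵐ D ∂dataLaw n P, ∀ i, ∃ k : Fin K, (D i).2 = Pi.single k 1 :=
  Filter.eventually_all.2 fun i =>
    (measurePreserving_eval_dataLaw i).quasiMeasurePreserving.ae hP

lemma integrable_sampleMean (hP : HasBasisResponse P) (hp₀ : IsTrueClassProb P p₀)
    (hφ : Measurable φ) (hint : ∀ k, Integrable (fun x => p₀ x k * φ x k) P.fst) :
    Integrable (sampleMean φ) (dataLaw n P) :=
  (integrable_finsetSum _ fun i _ => (measurePreserving_eval_dataLaw i).integrable_comp_of_integrable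
    (integrable_obsEval hP hp₀ hφ hint)).div_const _

lemma integral_sampleMean (hn : n ≠ 0) (hP : HasBasisResponse P) (hp₀ : IsTrueClassProb P p₀)
    (hφ : Measurable φ) (hint : ∀ k, Integrable (fun x => p₀ x k * φ x k) P.fst) :
    ∫ D, sampleMean φ D ∂dataLaw n P = ∫ x, ∑ k, p₀ x k * φ x k ∂P.fst := by
  have h (i : Fin n) : Integrable (fun D => obsEval φ (D i)) (dataLaw n P) :=
    (measurePreserving_eval_dataLaw i).integrable_comp_of_integrable
    (integrable_obsEval hP hp₀ hφ hint)
  simp only [sampleMean]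
  rw [integral_div, integral_finsetSum _ fun i _ => h i]
  have h2 (i : Fin n) : ∫ D, obsEval φ (D i) ∂dataLaw n P = ∫ z, obsEval φ z ∂P := by
    have hi := measurePreserving_eval_dataLaw (P := P) i
    have hmap := integral_map (μ := dataLaw n P) hi.measurable.aemeasurable (f := obsEval φ)
      (measurable_obsEval hφ).aestronglyMeasurable
    rw [hi.map_eq] at hmap
    exact hmap.symm
  simp only [h2, Finset.sum_const, Finset.card_univ, Fintype.card_fin, nsmul_eq_mul]
  rw [mul_div_cancel_left₀ _ (by exact_mod_cast hn), integral_obsEval hP hp₀ hφ hint]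

/-! ### The exponential moment of the truncated log-ratio -/

lemma integrable_of_measurable_of_abs_le {f : Cube d → ℝ} {c : ℝ} (hf : Measurable f)
    (hc : ∀ x, |f x| ≤ c) : Integrable f P.fst :=
  Integrable.of_bound hf.aestronglyMeasurable c (ae_of_all _ hc)

lemma abs_mul_truncLogRatio_le {B : ℝ} (hB : 0 ≤ B) (hp₀ : IsClassProb p₀)
    {p : Cube d → Fin K → ℝ} (hp : IsClassProb p) (k : Fin K) (x : Cube d) :
    |p₀ x k * truncLogRatio B p₀ p x k| ≤ B + 1 := by
  obtain ⟨h0, h1⟩ := coord_mem_Icc (hp₀.2 x) k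
  obtain ⟨h2, h3⟩ := coord_mem_Icc (hp.2 x) k
  rw [abs_mul, abs_of_nonneg h0]
  calc _ ≤ p₀ x k * (B - Real.log (p₀ x k)) :=
        mul_le_mul_of_nonneg_left (abs_truncLog_le hB h0 h1 h2 h3) h0
    _ = p₀ x k * B + p₀ x k * -Real.log (p₀ x k) := by ring
    _ ≤ _ := add_le_add (mul_le_of_le_one_left hB h1) (mul_neg_log_le_one h0)

lemma integrable_mul_truncLogRatio {B : ℝ} (hB : 0 ≤ B) (hp₀ : IsClassProb p₀)
    {p : Cube d → Fin K → ℝ} (hp : IsClassProb p) (k : Fin K) :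
    Integrable (fun x => p₀ x k * truncLogRatio B p₀ p x k) P.fst := by
  refine integrable_of_measurable_of_abs_le ?_ (abs_mul_truncLogRatio_le hB hp₀ hp k)
  have := measurable_truncLogRatio B hp₀.1 hp.1
  have := hp₀.1
  fun_prop

lemma integrable_klTrunc {B : ℝ} (hB : 1 ≤ B) (hp₀ : IsClassProb p₀)
    {p : Cube d → Fin K → ℝ} (hp : IsClassProb p) :
    Integrable (fun x => klTrunc B (p₀ x) (p x)) P.fst :=
  integrable_finsetSum _ fun k _ => integrable_mul_truncLogRatio (by linarith) hp₀ hp k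

/-- The deviation of the empirical mean of the truncated log-ratio below `1 - κ` times its
expectation has an exponential moment of order `n κ / (2 B)` bounded by one. -/
lemma integral_exp_deviation_le_one {B κ : ℝ} (hB : 2 ≤ B) (hκ : 0 ≤ κ) (hκ1 : κ ≤ 1)
    (hP : HasBasisResponse P) (hp₀ : IsTrueClassProb P p₀)
    {p : Cube d → Fin K → ℝ} (hp : IsClassProb p) (hn : n ≠ 0) :
    Integrable (fun D => Real.exp (n * (κ / (2 * B)) *
        ((1 - κ) * ∫ x, klTrunc B (p₀ x) (p x) ∂P.fst - sampleMean (truncLogRatio B p₀ p) D)))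
      (dataLaw n P) ∧
    ∫ D, Real.exp (n * (κ / (2 * B)) *
        ((1 - κ) * ∫ x, klTrunc B (p₀ x) (p x) ∂P.fst - sampleMean (truncLogRatio B p₀ p) D))
      ∂dataLaw n P ≤ 1 := by
  set ν := ∫ x, klTrunc B (p₀ x) (p x) ∂P.fst
  have hsum x := sum_mul_exp_neg_truncLog_le hB hκ hκ1 (hp₀.1.2 x) (hp.2 x)
  have hs : 0 ≤ κ / (2 * B) := by positivity
  set s := κ / (2 * B)
  have hm := measurable_truncLogRatio B hp₀.1.1 hp.1
  have hm0 := hp₀.1.1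
  have hmE : Measurable fun x k => Real.exp (-(s * truncLogRatio B p₀ p x k)) := by fun_prop
  have hnonneg x k : 0 ≤ p₀ x k * Real.exp (-(s * truncLogRatio B p₀ p x k)) :=
    mul_nonneg ((hp₀.1.2 x).1 k) (Real.exp_pos _).le
  have hintE k : Integrable (fun x => p₀ x k * Real.exp (-(s * truncLogRatio B p₀ p x k)))
      P.fst := by
    refine integrable_of_measurable_of_abs_le (c := 1) (by fun_prop) fun x => ?_
    rw [abs_of_nonneg (hnonneg x k)]
    refine (Finset.single_le_sum (fun k _ => hnonneg x k) (Finset.mem_univ k)).trans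
      ((hsum x).trans ?_)
    have := klTrunc_nonneg (B := B) (by linarith) (hp₀.1.2 x) (hp.2 x)
    have : 0 ≤ (1 - κ) * s * klTrunc B (p₀ x) (p x) := by
      have : 0 ≤ 1 - κ := by linarith
      positivity
    linarith
  let h : Obs d K → ℝ := fun z =>
    Real.exp (s * (1 - κ) * ν) * Real.exp (-(s * obsEval (truncLogRatio B p₀ p) z))
  have hae : h =ᵐ[P] fun z => Real.exp (s * (1 - κ) * ν) *
      obsEval (fun x k => Real.exp (-(s * truncLogRatio B p₀ p x k))) z := by
    filter_upwards [hP] with z ⟨k, hk⟩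
    simp only [h, obsEval_of_eq_single _ hk]
  have hhint : Integrable h P :=
    (integrable_congr hae).2 ((integrable_obsEval hP hp₀ hmE hintE).const_mul _)
  have hhle : ∫ z, h z ∂P ≤ 1 := by
    rw [integral_congr_ae hae, integral_const_mul, integral_obsEval hP hp₀ hmE hintE]
    have h1 : ∫ x, ∑ k, p₀ x k * Real.exp (-(s * truncLogRatio B p₀ p x k)) ∂P.fst ≤
        1 - (1 - κ) * s * ν := by
      have hkl := (integrable_klTrunc (P := P) (B := B) (by linarith) hp₀.1 hp).const_mul
        ((1 - κ) * s)
      refine (integral_mono (integrable_finsetSum _ fun k _ => hintE k)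
        ((integrable_const (1 : ℝ)).sub hkl) hsum).trans_eq ?_
      rw [integral_sub' (integrable_const _) hkl, integral_const_mul]
      simp [ν]
    have h2 := Real.add_one_le_exp (-(s * (1 - κ) * ν))
    calc _ ≤ Real.exp (s * (1 - κ) * ν) * Real.exp (-(s * (1 - κ) * ν)) := by
          gcongr
          linarith
      _ = 1 := by rw [← Real.exp_add, add_neg_cancel, Real.exp_zero]
  have hprod (D : Fin n → Obs d K) : Real.exp (n * s *
      ((1 - κ) * ν - sampleMean (truncLogRatio B p₀ p) D)) = ∏ i, h (D i) := by
    have hn' : (n : ℝ) ≠ 0 := by exact_mod_cast hn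
    simp only [h, ← Real.exp_add, ← Real.exp_sum]
    congr 1
    rw [Finset.sum_add_distrib, Finset.sum_neg_distrib, Finset.sum_const, ← Finset.mul_sum,
      sampleMean, Finset.card_univ, Fintype.card_fin, nsmul_eq_mul]
    field_simp
    ring
  simp only [hprod]
  constructor
  · exact Integrable.fintype_prod fun _ => hhint
  · rw [dataLaw, integral_fintype_prod_eq_prod (fun _ => h)]
    exact Finset.prod_le_one (fun i _ => integral_nonneg fun z => by positivity) fun i _ => hhle

end Transfer

/-! ### Empirical loss of the estimator -/

section Loss

variable {d K n : ℕ}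

lemma sampleMean_mono {φ ψ : Cube d → Fin K → ℝ} {D : Fin n → Obs d K}
    (hD : ∀ i, ∃ k : Fin K, (D i).2 = Pi.single k 1) (h : ∀ x k, φ x k ≤ ψ x k) :
    sampleMean φ D ≤ sampleMean ψ D := by
  unfold sampleMean
  gcongr with i
  obtain ⟨k, hk⟩ := hD i
  rw [obsEval_of_eq_single _ hk, obsEval_of_eq_single _ hk]
  exact h _ _

lemma sampleMean_add (φ ψ : Cube d → Fin K → ℝ) (D : Fin n → Obs d K) :
    sampleMean (fun x k => φ x k + ψ x k) D = sampleMean φ D + sampleMean ψ D := by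
  simp only [sampleMean, obsEval, mul_add, Finset.sum_add_distrib, add_div]

lemma sampleMean_neg (φ : Cube d → Fin K → ℝ) (D : Fin n → Obs d K) :
    sampleMean (fun x k => -φ x k) D = -sampleMean φ D := by
  simp only [sampleMean, obsEval, mul_neg, Finset.sum_neg_distrib, neg_div]

lemma abs_sampleMean_le {φ ψ : Cube d → Fin K → ℝ} {D : Fin n → Obs d K}
    (hD : ∀ i, ∃ k : Fin K, (D i).2 = Pi.single k 1) (h : ∀ x k, |φ x k| ≤ ψ x k) :
    |sampleMean φ D| ≤ sampleMean ψ D := by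
  refine abs_le.2 ⟨?_, sampleMean_mono hD fun x k => (le_abs_self _).trans (h x k)⟩
  rw [← sampleMean_neg]
  exact sampleMean_mono hD fun x k => (neg_le_neg (h x k)).trans (neg_abs_le _)

lemma toENNReal_neg_elog_zero : (-elog 0).toENNReal = ∞ := by
  simp [elog_zero]

lemma toENNReal_neg_elog_of_pos {u : ℝ} (hu : 0 < u) :
    (-elog u).toENNReal = ENNReal.ofReal (-Real.log u) := by
  rw [elog_of_pos hu, ← EReal.coe_neg, EReal.toENNReal_of_ne_top (EReal.coe_ne_top _),
    EReal.toReal_coe]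

lemma ofReal_sampleMean_le_ceLoss {φ q : Cube d → Fin K → ℝ} {D : Fin n → Obs d K} (hn : n ≠ 0)
    (hD : ∀ i, ∃ k : Fin K, (D i).2 = Pi.single k 1) (h0 : ∀ x k, 0 ≤ φ x k)
    (h : ∀ x k, ENNReal.ofReal (φ x k) ≤ (-elog (q x k)).toENNReal) :
    ENNReal.ofReal (sampleMean φ D) ≤ ceLoss q D := by
  have hn' : (0 : ℝ) < n := by exact_mod_cast Nat.pos_of_ne_zero hn
  have hobs i : 0 ≤ obsEval φ (D i) := by
    obtain ⟨k, hk⟩ := hD i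
    rw [obsEval_of_eq_single _ hk]
    exact h0 _ _
  rw [sampleMean, ceLoss, ENNReal.ofReal_div_of_pos hn', ENNReal.ofReal_natCast,
    ENNReal.ofReal_sum_of_nonneg fun i _ => hobs i]
  gcongr with i
  obtain ⟨k, hk⟩ := hD i
  rw [obsEval_of_eq_single _ hk]
  refine (h _ k).trans ?_
  calc (-elog (q (D i).1 k)).toENNReal
      = ENNReal.ofReal ((D i).2 k) * (-elog (q (D i).1 k)).toENNReal := by simp [hk]
    _ ≤ _ := Finset.single_le_sum
      (f := fun k => ENNReal.ofReal ((D i).2 k) * (-elog (q (D i).1 k)).toENNReal)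
      (fun _ _ => zero_le) (Finset.mem_univ k)

lemma truncLog_sub_log_le {B a b : ℝ} (hb : 0 ≤ b) :
    ENNReal.ofReal (truncLog B a b - Real.log a) ≤ (-elog b).toENNReal := by
  rcases hb.eq_or_lt with rfl | hb'
  · simp [toENNReal_neg_elog_zero]
  rw [toENNReal_neg_elog_of_pos hb']
  by_cases ha : a = 0
  · have hlog : truncLog B a b ≤ 0 := by simp [truncLog, hb'.ne', ha]
    rw [ha, Real.log_zero, sub_zero, ← ha, ENNReal.ofReal_of_nonpos hlog]
    exact zero_le
  · refine ENNReal.ofReal_le_ofReal ?_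
    have : truncLog B a b ≤ Real.log a - Real.log b := by
      rw [truncLog, if_neg hb'.ne', Real.log_div ha hb'.ne']
      exact min_le_right _ _
    linarith

/-- The cross-entropy is at most the Kullback-Leibler divergence plus the Shannon entropy. -/
lemma sum_mul_neg_elog_le {p q : Fin K → ℝ} (hp : p ∈ stdSimplex ℝ (Fin K))
    (hq : q ∈ stdSimplex ℝ (Fin K)) :
    ∑ k, ENNReal.ofReal (p k) * (-elog (q k)).toENNReal ≤
      klVec p q + ENNReal.ofReal (∑ k, p k * -Real.log (p k)) := by
  unfold klVec
  split_ifs with h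
  · refine le_trans (le_of_eq ?_) ENNReal.ofReal_add_le
    rw [← Finset.sum_add_distrib]
    have hterm k : p k * Real.log (p k / q k) + p k * -Real.log (p k) =
        p k * -Real.log (q k) := by
      rcases eq_or_ne (p k) 0 with h0 | h0
      · simp [h0]
      · rw [Real.log_div h0 fun hq0 => h0 (h k hq0)]
        ring
    simp only [hterm]
    rw [ENNReal.ofReal_sum_of_nonneg fun k _ => mul_nonneg (hp.1 k)
      (neg_nonneg.2 (Real.log_nonpos (coord_mem_Icc hq k).1 (coord_mem_Icc hq k).2))]
    refine Finset.sum_congr rfl fun k _ => ?_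
    rcases (hq.1 k).eq_or_lt with h0 | h0
    · simp [h k h0.symm]
    · rw [toENNReal_neg_elog_of_pos h0, ENNReal.ofReal_mul (hp.1 k)]
  · simp

lemma lintegral_ceLoss_sub_le_deltaN {P : Measure (Obs d K)}
    {phat : (Fin n → Obs d K) → Cube d → Fin K → ℝ} {F : Set (Cube d → Fin K → ℝ)}
    {p : Cube d → Fin K → ℝ} (hp : p ∈ F) :
    ∫⁻ D, (ceLoss (phat D) D - ceLoss p D) ∂dataLaw n P ≤ deltaN P F phat :=
  lintegral_mono fun D => tsub_le_tsub_left (iInf₂_le (f := fun p _ => ceLoss p D) p hp) _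

variable {P : Measure (Obs d K)} {p₀ : Cube d → Fin K → ℝ} [IsProbabilityMeasure P]

lemma measurable_neg_elog {q : Cube d → Fin K → ℝ} (hq : Measurable q) (k : Fin K) :
    Measurable fun x => (-elog (q x k)).toENNReal := by
  unfold elog
  fun_prop

lemma measurable_ceLoss {q : Cube d → Fin K → ℝ} (hq : Measurable q) :
    Measurable (ceLoss (n := n) q) := by
  unfold ceLoss
  have h k := measurable_neg_elog hq k
  refine Measurable.div_const (Finset.measurable_sum _ fun i _ => Finset.measurable_sum _
    fun k _ => Measurable.mul (by fun_prop) ?_) _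
  exact (h k).comp (measurable_fst.comp (measurable_pi_apply i))

lemma integrable_mul_log (hp₀ : IsClassProb p₀) (k : Fin K) :
    Integrable (fun x => p₀ x k * Real.log (p₀ x k)) P.fst := by
  have hm := hp₀.1
  refine integrable_of_measurable_of_abs_le (c := 1) (by fun_prop) fun x => ?_
  obtain ⟨h0, h1⟩ := coord_mem_Icc (hp₀.2 x) k
  rw [abs_mul, abs_of_nonneg h0, abs_of_nonpos (Real.log_nonpos h0 h1)]
  exact mul_neg_log_le_one h0

lemma lintegral_ceLoss_le (hn : n ≠ 0) (hP : HasBasisResponse P) (hp₀ : IsTrueClassProb P p₀)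
    {p : Cube d → Fin K → ℝ} (hp : IsClassProb p) :
    ∫⁻ D, ceLoss p D ∂dataLaw n P ≤ risk P p₀ p +
      ENNReal.ofReal (∫ x, ∑ k, p₀ x k * -Real.log (p₀ x k) ∂P.fst) := by
  have hψ k := measurable_neg_elog hp.1 k
  have hm0 := hp₀.1.1
  have hterm k : Measurable fun z : Obs d K =>
      ENNReal.ofReal (z.2 k) * (-elog (p z.1 k)).toENNReal :=
    Measurable.mul (by fun_prop) ((hψ k).comp measurable_fst)
  have hsum : Measurable fun z : Obs d K =>
      ∑ k, ENNReal.ofReal (z.2 k) * (-elog (p z.1 k)).toENNReal :=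
    Finset.measurable_sum _ fun k _ => hterm k
  have hterm' k : Measurable fun x => ENNReal.ofReal (p₀ x k) * (-elog (p x k)).toENNReal :=
    Measurable.mul (by fun_prop) (hψ k)
  have hsample (i : Fin n) : Measurable fun D : Fin n → Obs d K =>
      ∑ k, ENNReal.ofReal ((D i).2 k) * (-elog (p (D i).1 k)).toENNReal :=
    hsum.comp (measurable_pi_apply i)
  have hone (i : Fin n) : ∫⁻ D, ∑ k, ENNReal.ofReal ((D i).2 k) *
      (-elog (p (D i).1 k)).toENNReal ∂dataLaw n P =
      ∫⁻ x, ∑ k, ENNReal.ofReal (p₀ x k) * (-elog (p x k)).toENNReal ∂P.fst := by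
    rw [(measurePreserving_eval_dataLaw (P := P) i).lintegral_comp hsum,
      lintegral_finsetSum _ fun k _ => hterm k, lintegral_finsetSum _ fun k _ => hterm' k]
    exact Finset.sum_congr rfl fun k _ => lintegral_response_mul hP hp₀ k (hψ k)
  have hmean : ∫⁻ D, ceLoss p D ∂dataLaw n P =
      ∫⁻ x, ∑ k, ENNReal.ofReal (p₀ x k) * (-elog (p x k)).toENNReal ∂P.fst := by
    simp only [ceLoss, div_eq_mul_inv]
    rw [lintegral_mul_const' _ _ (by simpa using hn), lintegral_finsetSum _ fun i _ =>
      hsample i]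
    simp only [hone, Finset.sum_const, Finset.card_univ, Fintype.card_fin, nsmul_eq_mul]
    rw [mul_comm, ← mul_assoc, ENNReal.inv_mul_cancel (by simpa using hn) (by simp), one_mul]
  have hentm : Measurable fun x => ENNReal.ofReal (∑ k, p₀ x k * -Real.log (p₀ x k)) := by
    fun_prop
  have hint : Integrable (fun x => ∑ k, p₀ x k * -Real.log (p₀ x k)) P.fst :=
    integrable_finsetSum _ fun k _ => by
      simpa only [mul_neg] using! (integrable_mul_log hp₀.1 k).neg
  rw [hmean, ofReal_integral_eq_lintegral_ofReal hint (ae_of_all _ fun x =>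
      Finset.sum_nonneg fun k _ => mul_nonneg ((hp₀.1.2 x).1 k) (neg_nonneg.2 (Real.log_nonpos
        (coord_mem_Icc (hp₀.1.2 x) k).1 (coord_mem_Icc (hp₀.1.2 x) k).2))),
    risk, ← lintegral_add_right _ hentm]
  exact lintegral_mono fun x => sum_mul_neg_elog_le (hp₀.1.2 x) (hp.2 x)

variable {phat : (Fin n → Obs d K) → Cube d → Fin K → ℝ}

lemma integrable_sampleMean_estimator {B : ℝ} (hB : 0 ≤ B) (hP : HasBasisResponse P)
    (hp₀ : IsTrueClassProb P p₀)
    (hphat : Measurable fun z : (Fin n → Obs d K) × Cube d => phat z.1 z.2)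
    (hphat' : ∀ D, IsClassProb (phat D)) :
    Integrable (fun D => sampleMean (truncLogRatio B p₀ (phat D)) D) (dataLaw n P) := by
  have hm0 := hp₀.1.1
  have hmeas : Measurable fun D : Fin n → Obs d K =>
      sampleMean (truncLogRatio B p₀ (phat D)) D := by
    unfold sampleMean obsEval truncLogRatio
    refine Measurable.div_const (Finset.measurable_sum _ fun i _ => Finset.measurable_sum _
      fun k _ => Measurable.mul (by fun_prop) ?_) _
    have h1 : Measurable fun D : Fin n → Obs d K => phat D (D i).1 :=
      hphat.comp (f := fun D : Fin n → Obs d K => (D, (D i).1)) (by fun_prop)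
    exact (measurable_truncLog B).comp
      (f := fun D : Fin n → Obs d K => (p₀ (D i).1 k, phat D (D i).1 k)) (by fun_prop)
  have hbound : Integrable (sampleMean fun x k => B - Real.log (p₀ x k)) (dataLaw n P) := by
    refine integrable_sampleMean hP hp₀ (by fun_prop) fun k => ?_
    simp only [mul_sub]
    refine Integrable.sub (integrable_of_measurable_of_abs_le (c := B) (by fun_prop)
      fun x => ?_) (integrable_mul_log hp₀.1 k)
    obtain ⟨h0, h1⟩ := coord_mem_Icc (hp₀.1.2 x) k
    rw [abs_of_nonneg (by positivity)]
    exact mul_le_of_le_one_left hB h1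
  refine hbound.mono' hmeas.aestronglyMeasurable ?_
  filter_upwards [basisResponse_dataLaw hP] with D hD
  refine abs_sampleMean_le hD fun x k => ?_
  obtain ⟨h0, h1⟩ := coord_mem_Icc (hp₀.1.2 x) k
  obtain ⟨h2, h3⟩ := coord_mem_Icc ((hphat' D).2 x) k
  exact abs_truncLog_le hB h0 h1 h2 h3

/-- Adding the entropy of `p₀` to both sides turns the truncated log-ratio of the estimator into a
lower bound of its cross-entropy loss, and the risk of `p` into the expected loss of `p`. -/
lemma ofReal_integral_sampleMean_estimator_le {B : ℝ} (hB : 0 ≤ B) (hn : n ≠ 0)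
    (hP : HasBasisResponse P) (hp₀ : IsTrueClassProb P p₀)
    (hphat : Measurable fun z : (Fin n → Obs d K) × Cube d => phat z.1 z.2)
    (hphat' : ∀ D, IsClassProb (phat D)) {p : Cube d → Fin K → ℝ} (hp : IsClassProb p) :
    ENNReal.ofReal (∫ D, sampleMean (truncLogRatio B p₀ (phat D)) D ∂dataLaw n P) ≤
      risk P p₀ p + ∫⁻ D, (ceLoss (phat D) D - ceLoss p D) ∂dataLaw n P := by
  have hW := integrable_sampleMean_estimator hB hP hp₀ hphat hphat'
  have hm0 := hp₀.1.1
  have hmL : Measurable fun x k => -Real.log (p₀ x k) := by fun_prop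
  have hintL k : Integrable (fun x => p₀ x k * -Real.log (p₀ x k)) P.fst := by
    simpa only [mul_neg] using! (integrable_mul_log hp₀.1 k).neg
  have hL := integrable_sampleMean (n := n) hP hp₀ hmL hintL
  have hEL := integral_sampleMean hn hP hp₀ hmL hintL
  set H := ∫ x, ∑ k, p₀ x k * -Real.log (p₀ x k) ∂P.fst
  have hH0 : 0 ≤ H := integral_nonneg fun x => Finset.sum_nonneg fun k _ =>
    mul_nonneg ((hp₀.1.2 x).1 k) (neg_nonneg.2 (Real.log_nonpos
      (coord_mem_Icc (hp₀.1.2 x) k).1 (coord_mem_Icc (hp₀.1.2 x) k).2))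
  set W := ∫ D, sampleMean (truncLogRatio B p₀ (phat D)) D ∂dataLaw n P
  have hnonneg D x k : 0 ≤ truncLogRatio B p₀ (phat D) x k + -Real.log (p₀ x k) := by
    obtain ⟨h0, h1⟩ := coord_mem_Icc (hp₀.1.2 x) k
    obtain ⟨h2, h3⟩ := coord_mem_Icc ((hphat' D).2 x) k
    have := log_le_truncLog hB h0 h1 h2 h3
    simp only [truncLogRatio]
    linarith
  have hsum : ENNReal.ofReal (W + H) ≤ ∫⁻ D, ceLoss (phat D) D ∂dataLaw n P := by
    rw [← hEL, ← integral_add hW hL]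
    refine (ofReal_integral_eq_lintegral_ofReal (hW.add hL) ?_).trans_le ?_
    · filter_upwards [basisResponse_dataLaw hP] with D hD
      rw [Pi.add_apply, ← sampleMean_add]
      have h := sampleMean_mono (φ := fun _ _ => 0) hD (hnonneg D)
      simpa [sampleMean, obsEval] using h
    · refine lintegral_mono_ae ?_
      filter_upwards [basisResponse_dataLaw hP] with D hD
      rw [Pi.add_apply, ← sampleMean_add]
      refine ofReal_sampleMean_le_ceLoss hn hD (hnonneg D) fun x k => ?_
      exact truncLog_sub_log_le (((hphat' D).2 x).1 k)
  have hsplit : ∫⁻ D, ceLoss (phat D) D ∂dataLaw n P ≤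
      ∫⁻ D, (ceLoss (phat D) D - ceLoss p D) ∂dataLaw n P + (risk P p₀ p + ENNReal.ofReal H) :=
    calc _ ≤ ∫⁻ D, ((ceLoss (phat D) D - ceLoss p D) + ceLoss p D) ∂dataLaw n P :=
          lintegral_mono fun D => le_tsub_add
      _ = _ := lintegral_add_right _ (measurable_ceLoss hp.1)
      _ ≤ _ := add_le_add le_rfl (lintegral_ceLoss_le hn hP hp₀ hp)
  calc ENNReal.ofReal W = ENNReal.ofReal (W + H) - ENNReal.ofReal H := by
        rw [← ENNReal.ofReal_sub _ hH0, add_sub_cancel_right]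
    _ ≤ _ := by
      rw [tsub_le_iff_right]
      refine (hsum.trans hsplit).trans_eq ?_
      rw [← add_assoc, add_comm (risk P p₀ p)]

end Loss

/-! ### Comparison with the centers of a cover -/

section Oracle

variable {d K n : ℕ} {P : Measure (Obs d K)} {p₀ : Cube d → Fin K → ℝ} [IsProbabilityMeasure P]
  {phat : (Fin n → Obs d K) → Cube d → Fin K → ℝ}

/-- A linearized form of the soft-maximum bound: taking expectations needs no Jensen inequality. -/
lemma le_log_card_add_sum_exp {ι : Type*} [Fintype ι] [Nonempty ι] {r : ℝ} (hr : 0 < r)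
    (Z : ι → ℝ) (j : ι) :
    Z j ≤ (Real.log (Fintype.card ι) +
      ((∑ i, Real.exp (r * Z i)) / Fintype.card ι - 1)) / r := by
  have hN : (0 : ℝ) < Fintype.card ι := by exact_mod_cast Fintype.card_pos
  rw [le_div_iff₀ hr]
  have h1 := Real.log_le_sub_one_of_pos (div_pos (Real.exp_pos (r * Z j)) hN)
  rw [Real.log_div (Real.exp_pos _).ne' hN.ne', Real.log_exp] at h1
  have h2 : Real.exp (r * Z j) / Fintype.card ι ≤ (∑ i, Real.exp (r * Z i)) / Fintype.card ι := by
    gcongr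
    exact Finset.single_le_sum (f := fun i => Real.exp (r * Z i))
      (fun i _ => (Real.exp_pos _).le) (Finset.mem_univ j)
  linarith

lemma integrable_klTrunc_estimator {B : ℝ} (hB : 1 ≤ B) (hp₀ : IsClassProb p₀)
    (hphat : Measurable fun z : (Fin n → Obs d K) × Cube d => phat z.1 z.2)
    (hphat' : ∀ D, IsClassProb (phat D)) :
    Integrable (fun z : (Fin n → Obs d K) × Cube d => klTrunc B (p₀ z.2) (phat z.1 z.2))
      ((dataLaw n P).prod P.fst) := by
  have hm0 := hp₀.1
  have hmeas : Measurable fun z : (Fin n → Obs d K) × Cube d =>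
      klTrunc B (p₀ z.2) (phat z.1 z.2) := by
    simp only [klTrunc_eq_sum_truncLog]
    refine Finset.measurable_sum _ fun k _ => Measurable.mul (by fun_prop) ?_
    exact (measurable_truncLog B).comp
      (f := fun z : (Fin n → Obs d K) × Cube d => (p₀ z.2 k, phat z.1 z.2 k)) (by fun_prop)
  refine Integrable.of_bound hmeas.aestronglyMeasurable B (ae_of_all _ fun z => ?_)
  rw [Real.norm_of_nonneg (klTrunc_nonneg hB (hp₀.2 _) ((hphat' _).2 _))]
  exact klTrunc_le (hp₀.2 _) _

/-- The empirical-process step: the estimator is replaced by the nearest center `q j`, up to the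
approximation error on the coordinates where `p₀` is at least `m` and up to the small contribution
of the other coordinates, and the centers are handled by their exponential moments. -/
theorem truncRisk_le_of_cover {ι : Type*} [Fintype ι] [Nonempty ι] {B κ δ m : ℝ} (hB : 2 ≤ B)
    (hκ : 0 < κ) (hκ1 : κ ≤ 1) (hδ : 0 ≤ δ) (hm : 0 < m) (hme : Real.log m ≤ -1) (hn : n ≠ 0)
    (hP : HasBasisResponse P) (hp₀ : IsTrueClassProb P p₀)
    (hphat : Measurable fun z : (Fin n → Obs d K) × Cube d => phat z.1 z.2)
    (hphat' : ∀ D, IsClassProb (phat D))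
    (q : ι → Cube d → Fin K → ℝ) (hq : ∀ j, IsClassProb (q j))
    (hcover : ∀ D, ∃ j, ∀ x k, |(max ((Real.log m - B : ℝ) : EReal) (elog (phat D x k))).toReal -
      (max ((Real.log m - B : ℝ) : EReal) (elog (q j x k))).toReal| ≤ δ) :
    (1 - κ) * truncRisk P B p₀ phat ≤
      ∫ D, sampleMean (truncLogRatio B p₀ (phat D)) D ∂dataLaw n P +
        (2 - κ) * (δ + K * (m * (B - Real.log m))) +
        Real.log (Fintype.card ι) / (n * (κ / (2 * B))) := by
  have hB0 : 0 ≤ B := by linarith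
  have hm0 := hp₀.1.1
  have hn' : (0 : ℝ) < n := by exact_mod_cast Nat.pos_of_ne_zero hn
  have hN : (0 : ℝ) < Fintype.card ι := by exact_mod_cast Fintype.card_pos
  -- The approximation error on each coordinate.
  set φ : Cube d → Fin K → ℝ := fun x k =>
    δ + if p₀ x k < m then B - Real.log (p₀ x k) else 0 with hφdef
  have hφm : Measurable φ := by
    refine measurable_pi_lambda _ fun k => measurable_const.add (Measurable.ite ?_ ?_ ?_)
    · exact measurableSet_lt (by fun_prop) measurable_const
    · fun_prop
    · fun_prop
  have hφ0 x k : 0 ≤ φ x k := by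
    have := Real.log_nonpos (coord_mem_Icc (hp₀.1.2 x) k).1 (coord_mem_Icc (hp₀.1.2 x) k).2
    simp only [hφdef]
    split_ifs <;> linarith
  have hφle x k : p₀ x k * φ x k ≤ p₀ x k * δ + m * (B - Real.log m) := by
    have h0 := (coord_mem_Icc (hp₀.1.2 x) k).1
    simp only [hφdef, mul_add]
    refine add_le_add le_rfl ?_
    split_ifs with h
    · exact mul_sub_log_le hB0 h0 h.le hm hme
    · rw [mul_zero]
      exact mul_nonneg hm.le (by linarith)
  have hφint k : Integrable (fun x => p₀ x k * φ x k) P.fst := by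
    refine integrable_of_measurable_of_abs_le (c := δ + m * (B - Real.log m)) (by fun_prop)
      fun x => ?_
    obtain ⟨h0, h1⟩ := coord_mem_Icc (hp₀.1.2 x) k
    rw [abs_of_nonneg (mul_nonneg h0 (hφ0 x k))]
    have := mul_le_of_le_one_left hδ h1
    linarith [hφle x k]
  have hφE : ∫ x, ∑ k, p₀ x k * φ x k ∂P.fst ≤ δ + K * (m * (B - Real.log m)) := by
    refine (integral_mono (integrable_finsetSum _ fun k _ => hφint k)
      (integrable_const (δ + K * (m * (B - Real.log m)))) fun x => ?_).trans_eq (by simp)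
    refine (Finset.sum_le_sum fun k _ => hφle x k).trans_eq ?_
    rw [Finset.sum_add_distrib, ← Finset.sum_mul, (hp₀.1.2 x).2]
    simp
  set η := ∫ x, ∑ k, p₀ x k * φ x k ∂P.fst with hη
  have hSint := integrable_sampleMean (n := n) hP hp₀ hφm hφint
  have hSE := integral_sampleMean hn hP hp₀ hφm hφint
  -- The deviations of the centers.
  set r : ℝ := n * (κ / (2 * B))
  have hr0 : 0 < r := by positivity
  set Z : ι → (Fin n → Obs d K) → ℝ := fun j D =>
    (1 - κ) * ∫ x, klTrunc B (p₀ x) (q j x) ∂P.fst - sampleMean (truncLogRatio B p₀ (q j)) D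
    with hZ
  have hexp j := integral_exp_deviation_le_one hB hκ.le hκ1 hP hp₀ (hq j) hn
  set M : (Fin n → Obs d K) → ℝ := fun D => (Real.log (Fintype.card ι) +
    ((∑ i, Real.exp (r * Z i D)) / Fintype.card ι - 1)) / r with hM
  have hsumint : Integrable (fun D => ∑ i, Real.exp (r * Z i D)) (dataLaw n P) :=
    integrable_finsetSum _ fun i _ => (hexp i).1
  have hMint : Integrable M (dataLaw n P) :=
    (((integrable_const _).add ((hsumint.div_const _).sub (integrable_const _))).div_const _)
  have hME : ∫ D, M D ∂dataLaw n P ≤ Real.log (Fintype.card ι) / r := by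
    have hsum : ∫ D, ∑ i, Real.exp (r * Z i D) ∂dataLaw n P ≤ Fintype.card ι := by
      rw [integral_finsetSum _ fun i _ => (hexp i).1]
      exact (Finset.sum_le_sum fun i _ => (hexp i).2).trans_eq (by simp)
    have hd := hsumint.div_const (Fintype.card ι : ℝ)
    simp only [hM]
    rw [integral_div, integral_add (g := fun D => (∑ i, Real.exp (r * Z i D)) / Fintype.card ι - 1)
      (integrable_const _) (hd.sub (integrable_const _)),
      integral_sub (hsumint.div_const _) (integrable_const _), integral_div]
    simp only [integral_const, probReal_univ, one_smul]
    gcongr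
    have := (div_le_one hN).2 hsum
    linarith
  -- The comparison for a fixed dataset.
  have hV := integrable_klTrunc_estimator (P := P) (B := B) (by linarith) hp₀.1 hphat hphat'
  have hVint := hV.integral_prod_left
  have hW := integrable_sampleMean_estimator hB0 hP hp₀ hphat hphat'
  have hpoint : ∀ᵐ D ∂dataLaw n P, (1 - κ) * ∫ x, klTrunc B (p₀ x) (phat D x) ∂P.fst ≤
      sampleMean (truncLogRatio B p₀ (phat D)) D + ((1 - κ) * η + (sampleMean φ D + M D)) := by
    filter_upwards [basisResponse_dataLaw hP] with D hD
    obtain ⟨j, hj⟩ := hcover D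
    have habs x k : |truncLogRatio B p₀ (phat D) x k - truncLogRatio B p₀ (q j) x k| ≤ φ x k := by
      obtain ⟨h0, h1⟩ := coord_mem_Icc (hp₀.1.2 x) k
      obtain ⟨h2, h3⟩ := coord_mem_Icc ((hphat' D).2 x) k
      obtain ⟨h4, h5⟩ := coord_mem_Icc ((hq j).2 x) k
      exact abs_truncLog_sub_le hB0 hm hδ h0 h1 h2 h3 h4 h5 (hj x k)
    have hpop : ∫ x, klTrunc B (p₀ x) (phat D x) ∂P.fst ≤
        ∫ x, klTrunc B (p₀ x) (q j x) ∂P.fst + η := by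
      have hi1 := integrable_klTrunc (P := P) (B := B) (by linarith) hp₀.1 (hq j)
      have hi2 := integrable_finsetSum Finset.univ fun k _ => hφint k
      rw [hη, ← integral_add hi1 hi2]
      refine integral_mono (integrable_klTrunc (by linarith) hp₀.1 (hphat' D)) (hi1.add hi2)
        fun x => ?_
      simp only [klTrunc_eq_sum_truncLog]
      rw [← Finset.sum_add_distrib]
      refine Finset.sum_le_sum fun k _ => ?_
      rw [← mul_add]
      refine mul_le_mul_of_nonneg_left ?_ ((hp₀.1.2 x).1 k)
      have := (abs_le.1 (habs x k)).2
      simp only [truncLogRatio] at this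
      linarith
    have hemp : sampleMean (truncLogRatio B p₀ (q j)) D ≤
        sampleMean (truncLogRatio B p₀ (phat D)) D + sampleMean φ D := by
      rw [← sampleMean_add]
      refine sampleMean_mono hD fun x k => ?_
      linarith [(abs_le.1 (habs x k)).1]
    have hdev : Z j D ≤ M D := le_log_card_add_sum_exp hr0 (fun j => Z j D) j
    have := mul_le_mul_of_nonneg_left hpop (sub_nonneg.2 hκ1)
    simp only [hZ] at hdev
    linarith
  have hfin := integral_mono_ae (hVint.const_mul (1 - κ))
    (hW.add ((integrable_const ((1 - κ) * η)).add (hSint.add hMint))) hpoint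
  rw [integral_const_mul, integral_add' hW ((integrable_const _).add (hSint.add hMint)),
    integral_add' (integrable_const _) (hSint.add hMint), integral_add' hSint hMint, hSE] at hfin
  simp only [integral_const, probReal_univ, one_smul] at hfin
  rw [truncRisk, integral_prod _ hV]
  have h1 := mul_le_mul_of_nonneg_left hφE (sub_nonneg.2 hκ1)
  linarith

/-! ### Covering numbers -/

/-- A finite covering number with respect to `d_τ` provides centers in the class itself. -/
lemma exists_centers_of_coverNum_eq {F : Set (Cube d → Fin K → ℝ)} {τ δ : ℝ} (hδ : 0 ≤ δ)
    {N : ℕ} (hN : coverNum τ δ (logClass F) = N) :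
    ∃ q : Fin N → Cube d → Fin K → ℝ, (∀ j, q j ∈ F) ∧ ∀ p ∈ F, ∃ j, ∀ x k,
      |(max (τ : EReal) (elog (p x k))).toReal -
        (max (τ : EReal) (elog (q j x k))).toReal| ≤ δ := by
  let := dTruncSpace (d := d) (K := K) τ
  have hN' : Metric.coveringNumber δ.toNNReal (logClass F) = N := hN
  obtain ⟨S, hSF, hSfin, hcov, hcard⟩ := Metric.exists_set_encard_eq_coveringNumber
    (hN'.trans_ne (ENat.natCast_ne_top N))
  have hncard : S.ncard = N := by
    rw [Set.ncard, hcard, hN', ENat.toNat_natCast]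
  have : Finite S := hSfin
  let e : Fin N ≃ S := (Finite.equivFinOfCardEq (by rw [Nat.card_coe_set_eq, hncard])).symm
  choose g hgF hg using fun f : S => hSF f.2
  refine ⟨fun j => g (e j), fun j => hgF _, fun p hp => ?_⟩
  obtain ⟨f, hfS, hf⟩ := hcov (Set.mem_image_of_mem _ hp)
  refine ⟨e.symm ⟨f, hfS⟩, fun x k => ?_⟩
  have hd : dTrunc τ (fun x k => elog (p x k)) f ≤ ENNReal.ofReal δ := hf
  have hxk : ENNReal.ofReal |(max (τ : EReal) (elog (p x k))).toReal -
      (max (τ : EReal) (f x k)).toReal| ≤ ENNReal.ofReal δ :=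
    iSup_le_iff.1 (iSup_le_iff.1 hd x) k
  rw [ENNReal.ofReal_le_ofReal_iff hδ] at hxk
  have hgf : (fun x k => elog (g (e (e.symm ⟨f, hfS⟩)) x k)) = f := by
    rw [e.apply_symm_apply]
    exact hg ⟨f, hfS⟩
  rw [← hgf] at hxk
  exact hxk

end Oracle

/-! ### The oracle inequality -/

theorem mainTheorem2 {d K n : ℕ} (hK : 2 ≤ K)
    (P : Measure (Obs d K)) [IsProbabilityMeasure P] (hP : HasBasisResponse P)
    (p₀ : Cube d → Fin K → ℝ) (hp₀ : IsTrueClassProb P p₀)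
    (F : Set (Cube d → Fin K → ℝ)) (hF : ∀ p ∈ F, IsClassProb p)
    (phat : (Fin n → Obs d K) → Cube d → Fin K → ℝ)
    (hphat_meas : Measurable fun z : (Fin n → Obs d K) × Cube d => phat z.1 z.2)
    (hphat_mem : ∀ D, phat D ∈ F)
    (B δ ε C : ℝ) (hB : 2 ≤ B) (hδ : δ ∈ Set.Ioc (0 : ℝ) 1) (hε : ε ∈ Set.Ioc (0 : ℝ) 1)
    (hC : 0 < C) (hCn : C ≤ n * (Real.exp 1)⁻¹)
    (N : ℕ∞) (hN : N = coverNum (Real.log (C * Real.exp (-B) / n)) δ (logClass F))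
    (hN3 : 3 ≤ N) :
    (truncRisk P B p₀ phat : EReal) ≤
      ((1 + ε : ℝ) : EReal) *
          ((((⨅ p ∈ F, risk P p₀ p) + deltaN P F phat : ℝ≥0∞) : EReal) + ((3 * δ : ℝ) : EReal))
        + (((1 + ε) ^ 2 / ε / n : ℝ) : EReal) *
          (((68 * B : ℝ) : EReal) * ENNReal.log (N : ℝ≥0∞)
            + ((272 * B + (3 / 2) * C * K * (Real.log (n / C) + B) : ℝ) : EReal)) := by
  obtain ⟨hε0, hε1⟩ := hε
  have hn : n ≠ 0 := by
    rintro rfl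
    simp only [Nat.cast_zero, zero_mul] at hCn
    linarith
  have hn' : (0 : ℝ) < n := by exact_mod_cast Nat.pos_of_ne_zero hn
  have hB0 : 0 < B := by linarith
  have hcoef : (0 : ℝ) < (1 + ε) ^ 2 / ε / n := by positivity
  -- The expected empirical truncated risk of the estimator is at most `inf R + Δ_n`.
  set W := ∫ D, sampleMean (truncLogRatio B p₀ (phat D)) D ∂dataLaw n P with hWdef
  have hW : ENNReal.ofReal W ≤ (⨅ p ∈ F, risk P p₀ p) + deltaN P F phat := by
    rw [← tsub_le_iff_right]
    refine le_iInf₂ fun p hp => ?_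
    rw [tsub_le_iff_right]
    exact (ofReal_integral_sampleMean_estimator_le hB0.le hn hP hp₀ hphat_meas
      (fun D => hF _ (hphat_mem D)) (hF p hp)).trans
      (add_le_add le_rfl (lintegral_ceLoss_sub_le_deltaN hp))
  set S := (⨅ p ∈ F, risk P p₀ p) + deltaN P F phat
  have hWS : (W : EReal) ≤ (S : EReal) := by
    refine le_trans ?_ (EReal.coe_ennreal_le_coe_ennreal_iff.2 hW)
    rw [EReal.coe_ennreal_ofReal]
    exact_mod_cast le_max_left W 0
  induction N using ENat.recTopCoe with
  | top =>
    have hS0 : ((1 + ε : ℝ) : EReal) * ((S : EReal) + ((3 * δ : ℝ) : EReal)) ≠ ⊥ := by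
      refine bot_lt_iff_ne_bot.1 (lt_of_lt_of_le EReal.bot_lt_zero ?_)
      refine mul_nonneg (by exact_mod_cast (by linarith : (0 : ℝ) ≤ 1 + ε))
        (add_nonneg (EReal.coe_ennreal_nonneg S) ?_)
      have := hδ.1
      exact_mod_cast (by positivity : (0 : ℝ) ≤ 3 * δ)
    rw [ENat.toENNReal_top, ENNReal.log_top, EReal.coe_mul_top_of_pos (by positivity),
      EReal.top_add_coe, EReal.coe_mul_top_of_pos hcoef, EReal.add_top_of_ne_bot hS0]
    exact le_top
  | coe N =>
    have hN3' : 3 ≤ N := by exact_mod_cast hN3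
    have hNpos : (0 : ℝ) < N := by
      have : 0 < N := by omega
      exact_mod_cast this
    set m := C / n with hm
    have hm0 : 0 < m := by positivity
    have hlogm : Real.log m ≤ -1 := by
      have : m ≤ Real.exp (-1) := by
        rw [hm, div_le_iff₀ hn', Real.exp_neg, mul_comm]
        exact hCn
      calc Real.log m ≤ Real.log (Real.exp (-1)) := Real.log_le_log hm0 this
        _ = -1 := Real.log_exp _
    have hτ : Real.log (C * Real.exp (-B) / n) = Real.log m - B := by
      rw [mul_div_right_comm, Real.log_mul hm0.ne' (Real.exp_pos _).ne', Real.log_exp]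
      ring
    rw [hτ] at hN
    obtain ⟨q, hqF, hq⟩ := exists_centers_of_coverNum_eq hδ.1.le hN.symm
    have : Nonempty (Fin N) := ⟨⟨0, by omega⟩⟩
    -- The value of `κ` for which `1 - κ = 1 / (1 + ε)`.
    have hmain := truncRisk_le_of_cover (κ := ε / (1 + ε)) hB (by positivity)
      ((div_le_one (by linarith)).2 (by linarith)) hδ.1.le hm0 hlogm hn hP hp₀ hphat_meas
      (fun D => hF _ (hphat_mem D)) q (fun j => hF _ (hqF j)) fun D => hq _ (hphat_mem D)
    rw [Fintype.card_fin, ← hWdef] at hmain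
    have hlogN : (0 : ℝ) ≤ Real.log N := Real.log_nonneg (by exact_mod_cast (by omega : 1 ≤ N))
    have hlogm' : Real.log (n / C) = -Real.log m := by
      rw [hm, ← Real.log_inv, inv_div]
    have hreal : truncRisk P B p₀ phat ≤ (1 + ε) * (W + 3 * δ) + (1 + ε) ^ 2 / ε / n *
        (68 * B * Real.log N + (272 * B + (3 / 2) * C * K * (Real.log (n / C) + B))) := by
      rw [hlogm']
      set R := truncRisk P B p₀ phat
      set T := C * K * (B - Real.log m) with hT
      have hT0 : 0 ≤ T := by
        have : 0 ≤ B - Real.log m := by linarith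
        positivity
      have hKm : K * (m * (B - Real.log m)) = T / n := by
        rw [hT, hm]; field_simp
      rw [hKm] at hmain
      have hmul : R ≤ (1 + ε) * W + (2 + ε) * (δ + T / n) +
          (1 + ε) ^ 2 / ε / n * (2 * B * Real.log N) := by
        have h := mul_le_mul_of_nonneg_left hmain (by linarith : (0 : ℝ) ≤ 1 + ε)
        calc R = (1 + ε) * ((1 - ε / (1 + ε)) * R) := by field_simp; ring
          _ ≤ _ := h
          _ = _ := by field_simp; ring
      -- The factor `4 · 3/2` dominates the coefficient `2 + ε` of the remainder `T / n`.
      have h4 : 4 ≤ (1 + ε) ^ 2 / ε := by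
        rw [le_div_iff₀ hε0]
        nlinarith [sq_nonneg (1 - ε)]
      have hTn : (2 + ε) * (T / n) ≤ (1 + ε) ^ 2 / ε / n * (3 / 2 * T) := by
        calc (2 + ε) * (T / n) ≤ (4 * (3 / 2)) * (T / n) := by
              gcongr; linarith
          _ ≤ ((1 + ε) ^ 2 / ε * (3 / 2)) * (T / n) := by gcongr
          _ = _ := by ring
      have hδε : (2 + ε) * δ ≤ (1 + ε) * (3 * δ) := by nlinarith [hδ.1]
      have hrest : (1 + ε) ^ 2 / ε / n * (2 * B * Real.log N) ≤
          (1 + ε) ^ 2 / ε / n * (68 * B * Real.log N + 272 * B) := by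
        gcongr
        have : 0 ≤ B * Real.log N := by positivity
        linarith
      have hexpand : (1 + ε) ^ 2 / ε / n *
          (68 * B * Real.log N + (272 * B + 3 / 2 * C * K * (-Real.log m + B))) =
          (1 + ε) ^ 2 / ε / n * (68 * B * Real.log N + 272 * B) +
            (1 + ε) ^ 2 / ε / n * (3 / 2 * T) := by
        rw [hT]; ring
      rw [hexpand]
      linarith
    have hlogcoe : ENNReal.log ((N : ℕ∞) : ℝ≥0∞) = ((Real.log N : ℝ) : EReal) := by
      rw [ENat.toENNReal_coe, ← ENNReal.ofReal_natCast, ENNReal.log_ofReal_of_pos hNpos]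
    rw [hlogcoe]
    calc (truncRisk P B p₀ phat : EReal) ≤ _ := EReal.coe_le_coe_iff.2 hreal
      _ = ((1 + ε : ℝ) : EReal) * ((W : EReal) + ((3 * δ : ℝ) : EReal)) +
          (((1 + ε) ^ 2 / ε / n : ℝ) : EReal) * (((68 * B : ℝ) : EReal) *
            ((Real.log N : ℝ) : EReal) +
            ((272 * B + (3 / 2) * C * K * (Real.log (n / C) + B) : ℝ) : EReal)) := by
        simp only [EReal.coe_add, EReal.coe_mul]
      _ ≤ _ := by
        refine add_le_add (mul_le_mul_of_nonneg_left (add_le_add hWS le_rfl) ?_) le_rfl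
        exact_mod_cast (by linarith : (0 : ℝ) ≤ 1 + ε)
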